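/- Let $(\boldsymbol d,\boldsymbol k)$ be the architecture of a one-dimensional linear convolutional network with $L$ layers and stride one: $d_0,\dots,d_L\ge 1$ and $k_1,\dots,k_L\ge 1$ are integers with $d_l=d_{l-1}-k_l+1$ for $l=1,\dots,L$. A filter $w_l=(w_{l,0},\dots,w_{l,k_l-1})\in\mathbb R^{k_l}$ defines the convolutional matrix $W_l\in\mathbb R^{d_l\times d_{l-1}}$ by $(W_lx)_i=\sum_{j=0}^{k_l-1}w_{l,j}\,x_{i+j}$, and the parameterization map is $\mu(w_1,\dots,w_L)=W_L\cdots W_1\in\mathbb R^{d_L\times d_0}$. Associate with a filter $w\in\mathbb R^{k}$ the homogeneous polynomial $\pi(w)=\sum_{j=0}^{k-1}w_j\,\mathsf x^{k-1-j}\mathsf y^{j}\in\mathbb R[\mathsf x,\mathsf y]$. We say that $\pi(w)$ has a repeated root if some point of $\mathbb P^1(\mathbb C)$ is a root of it of multiplicity at least two. For data matrices $X\in\mathbb R^{d_0\times N}$ and $Y\in\mathbb R^{d_L\times N}$ consider the square loss $\mathcal L(\theta)=\|\mu(\theta)X-Y\|_F^2$, where $\theta=(w_1,\dots,w_L)\in\mathbb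 R^{k_1}\times\cdots\times\mathbb R^{k_L}$. **Theorem.** Let $N\ge d_0$. For generic data matrices $X\in\mathbb R^{d_0\times N}$ and $Y\in\mathbb R^{d_L\times N}$ (that is, for all $(X,Y)$ outside the zero set of some nonzero real polynomial in the entries of $X$ and $Y$, which depends only on the architecture and $N$), every critical point $\theta=(w_1,\dots,w_L)$ of $\mathcal L$ with nonzero end-to-end matrix $\mu(\theta)\ne 0$ satisfies that none of the polynomials $\pi(w_1),\dots,\pi(w_L)$ has a repeated root. -/

import Mathlib

noncomputable section

namespace LCN

/-- An architecture of a one-dimensional linear convolutional network with `L` layers: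
dimensions `d 0, …, d L`, filter sizes `k` and strides `s` (layer `l + 1` has filter size `k l`
and stride `s l`), compatible in the sense that `d (l + 1) = (d l - k l) / s l + 1`. -/
structure Architecture (L : ℕ) where
  d : Fin (L + 1) → ℕ
  k : Fin L → ℕ
  s : Fin L → ℕ
  d_pos : ∀ l, 0 < d l
  k_pos : ∀ l, 0 < k l
  s_pos : ∀ l, 0 < s l
  compatible : ∀ l : Fin L, d l.castSucc = s l * (d l.succ - 1) + k l

/-- The `m × n` convolutional (generalized Toeplitz) matrix with filter `w` and stride `s`:
it sends `x` to the vector with `i`-th entry `∑ j, w j * x (i * s + j)`. -/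
def convMatrix (m n : ℕ) {k : ℕ} (s : ℕ) (w : Fin k → ℝ) : Matrix (Fin m) (Fin n) ℝ :=
  fun i c => ∑ j : Fin k, if (c : ℕ) = i * s + j then w j else 0

namespace Architecture

variable {L : ℕ} (A : Architecture L)

/-- The space of parameters `θ = (w₁, …, w_L)`: one filter of size `k l` for every layer. -/
abbrev Params : Type := (l : Fin L) → Fin (A.k l) → ℝ

/-- The convolutional matrix of one layer. -/
def layer (θ : A.Params) (l : Fin L) : Matrix (Fin (A.d l.succ)) (Fin (A.d l.castSucc)) ℝ :=
  convMatrix (A.d l.succ) (A.d l.castSucc) (A.s l) (θ l)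

/-- The product `W_l ⋯ W₁` of the matrices of the first `l` layers. -/
def partialProduct (θ : A.Params) (l : Fin (L + 1)) : Matrix (Fin (A.d l)) (Fin (A.d 0)) ℝ :=
  Fin.induction (motive := fun l => Matrix (Fin (A.d l)) (Fin (A.d 0)) ℝ)
    1 (fun i M => A.layer θ i * M) l

/-- The parameterization map `μ`, sending `θ` to the end-to-end matrix `W_L ⋯ W₁`. -/
def mu (θ : A.Params) : Matrix (Fin (A.d (Fin.last L))) (Fin (A.d 0)) ℝ :=
  A.partialProduct θ (Fin.last L)

end Architecture

/-- The square loss `‖W X - Y‖²` (Frobenius norm) in the space of matrices. -/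
def squareLoss {m n N : ℕ} (X : Matrix (Fin n) (Fin N) ℝ) (Y : Matrix (Fin m) (Fin N) ℝ)
    (W : Matrix (Fin m) (Fin n) ℝ) : ℝ :=
  ∑ i, ∑ j, ((W * X - Y) i j) ^ 2

/-- `θ` is a critical point of `f`: the differential of `f` at `θ` exists and is zero. For a
polynomial function of the filters, such as the square loss of a network, this means
that all partial derivatives vanish. -/
def IsCritical {L : ℕ} (A : Architecture L) (f : A.Params → ℝ) (θ : A.Params) : Prop :=
  HasFDerivAt f (0 : A.Params →L[ℝ] ℝ) θ

/-- The homogeneous polynomial `w₀ x^(k-1) + w₁ x^(k-2) y + ⋯ + w_(k-1) y^(k-1)` of a filter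
of size `k`, where `x` is the variable `0` and `y` the variable `1`. -/
def filterPoly {k : ℕ} (w : Fin k → ℝ) : MvPolynomial (Fin 2) ℝ :=
  ∑ j : Fin k, MvPolynomial.C (w j) * MvPolynomial.X 0 ^ (k - 1 - (j : ℕ)) *
    MvPolynomial.X 1 ^ (j : ℕ)

/-- A homogeneous bivariate real polynomial has a repeated root if some point `(r₀ : r₁)` of the
complex projective line is a root of multiplicity at least two, that is, if the square of the
linear form `r₁ x - r₀ y` divides it over `ℂ`. -/
def HasRepeatedRoot (p : MvPolynomial (Fin 2) ℝ) : Prop :=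
  ∃ r : Fin 2 → ℂ, r ≠ 0 ∧
    (MvPolynomial.C (r 1) * MvPolynomial.X 0 - MvPolynomial.C (r 0) * MvPolynomial.X 1) ^ 2 ∣
      MvPolynomial.map (algebraMap ℝ ℂ) p

/-- `S X Y` holds for generic data matrices `X`, `Y`: it holds outside the zero set of some
nonzero real polynomial in the entries of `X` and `Y`. -/
def ForGenericData {n m N : ℕ}
    (S : Matrix (Fin n) (Fin N) ℝ → Matrix (Fin m) (Fin N) ℝ → Prop) : Prop :=
  ∃ P : MvPolynomial ((Fin n × Fin N) ⊕ (Fin m × Fin N)) ℝ, P ≠ 0 ∧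
    ∀ (X : Matrix (Fin n) (Fin N) ℝ) (Y : Matrix (Fin m) (Fin N) ℝ),
      MvPolynomial.eval (Sum.elim (fun a => X a.1 a.2) (fun b => Y b.1 b.2)) P ≠ 0 → S X Y

end LCN

end

noncomputable section

/-! ### Filters as univariate polynomials: composing stride-one layers multiplies them. -/

namespace LCN

open Polynomial

/-! The proof is a dimension count. With stride one the end-to-end matrix is the convolution by `P =
∏ l, p l`, where `p l` is the generating polynomial of layer `l`, so the loss depends on `P` alone.
Put `K = 1 + ∑ l, (k l - 1)`, the size of the end-to-end filter. The differential of the loss at `P`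
is, up to a factor of two, a linear form `G` on polynomials of degree below `K`. Criticality says
that `G` kills `f * ∏ j ≠ l, p j` for every layer `l` and every `f` of degree at most `k l - 1`.

Over `ℂ`, let `P` have `r` distinct roots `x i` of multiplicities `a i`. Choose for each root one
layer in which it occurs, with multiplicity `μ i ≥ 1`, and put `b i = a i - μ i`. By partial
fractions (`map_mul_eq_zero_of_layers`) `G` kills the multiples of `∏ i, (X - x i) ^ b i` up to
degree `D = deg P + δ`, where `δ` is the drop of the degree of `p l₀` below `k l₀ - 1` for a chosen
layer `l₀`. Hence `G (X ^ j)`, `j ≤ D`, is a linear recurrence sequence given by `∑ b i` initial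
values (`map_X_pow_eq_sum_modByMonic`), and `K - 1 - D` values remain free.

The normal equations express the data vector in `K`-space through the data matrix `X`, the leading
coefficient, the roots and these values: `1 + r + ∑ b i + (K - 1 - D) = K + r - ∑ μ i - δ`
parameters besides `X`. If `p l₀` has a repeated root, then either some `μ i ≥ 2` or, for a root at
infinity, `δ ≥ 1`; so there are fewer than `K` parameters. By transcendence degree
(`exists_relation`) the data vector then satisfies a nontrivial polynomial relation with
coefficients depending on `X`. Such a relation is nontrivial in the data because `K ≤ d 0 ≤ N` lets
the data vector take any value (`exists_dataVec_pullback`). Only finitely many tuples `(r, a, b, D)`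
occur, so the product of their relations works. -/

/-- The generating polynomial `∑ j, w j * X ^ j` of a filter. -/
def genPoly {k : ℕ} (w : Fin k → ℝ) : ℝ[X] := ∑ j : Fin k, C (w j) * X ^ (j : ℕ)

/-- The generating polynomial of a row of a matrix. -/
def rowPoly {m n : ℕ} (M : Matrix (Fin m) (Fin n) ℝ) (i : Fin m) : ℝ[X] := genPoly (M i)

theorem genPoly_coeff {k : ℕ} (w : Fin k → ℝ) (j : Fin k) : (genPoly w).coeff j = w j := by
  simp only [genPoly, finsetSum_coeff, coeff_C_mul, coeff_X_pow]
  rw [Finset.sum_eq_single j] <;> simp +contextual [Fin.ext_iff, eq_comm]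

theorem genPoly_natDegree_lt {k : ℕ} (hk : 0 < k) (w : Fin k → ℝ) : (genPoly w).natDegree < k := by
  have : (genPoly w).natDegree ≤ k - 1 := by
    refine natDegree_sum_le_of_forall_le _ _ fun j _ => ?_
    exact (natDegree_C_mul_X_pow_le _ _).trans (by omega)
  omega

theorem genPoly_add {k : ℕ} (v w : Fin k → ℝ) : genPoly (v + w) = genPoly v + genPoly w := by
  simp [genPoly, add_mul, Finset.sum_add_distrib]

theorem genPoly_smul {k : ℕ} (t : ℝ) (w : Fin k → ℝ) : genPoly (t • w) = C t * genPoly w := by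
  simp [genPoly, Finset.mul_sum, mul_assoc]

theorem genPoly_single {k : ℕ} (j : Fin k) : genPoly (Pi.single j 1) = X ^ (j : ℕ) := by
  rw [genPoly, Finset.sum_eq_single j] <;> simp +contextual

theorem rowPoly_mul {l m n : ℕ} (M : Matrix (Fin l) (Fin m) ℝ) (M' : Matrix (Fin m) (Fin n) ℝ)
    (i : Fin l) : rowPoly (M * M') i = ∑ b, C (M i b) * rowPoly M' b := by
  simp only [rowPoly, genPoly, Matrix.mul_apply, map_sum, Finset.sum_mul, Finset.mul_sum, map_mul]
  rw [Finset.sum_comm]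
  simp only [mul_assoc]

/-- Row `i` is the filter shifted by `i`; the hypothesis on `n` guarantees that no shifted entry
leaves the matrix. -/
theorem rowPoly_convMatrix {m n k : ℕ} (w : Fin k → ℝ) (hn : n = m - 1 + k) (i : Fin m) :
    rowPoly (convMatrix m n 1 w) i = X ^ (i : ℕ) * genPoly w := by
  simp only [rowPoly, genPoly, convMatrix, map_sum, Finset.sum_mul, Finset.mul_sum]
  rw [Finset.sum_comm]
  refine Finset.sum_congr rfl fun j _ => ?_
  rw [Finset.sum_eq_single ⟨i + j, by omega⟩]
  · simp only [mul_one, if_true, pow_add]; ring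
  · intro b _ hb
    rw [if_neg, map_zero, zero_mul]
    exact fun h => hb (Fin.ext (by simpa using h))
  · simp

namespace Architecture

variable {L : ℕ} (A : Architecture L)

/-- The generating polynomial of the end-to-end filter of a stride one network. -/
def endPoly (θ : A.Params) : ℝ[X] := ∏ l, genPoly (θ l)

theorem rowPoly_partialProduct (hs : ∀ l, A.s l = 1) (θ : A.Params) (l : Fin (L + 1)) :
    ∀ i, rowPoly (A.partialProduct θ l) i =
      X ^ (i : ℕ) * ∏ j ∈ Finset.univ.filter (fun j : Fin L => j.castSucc < l), genPoly (θ j) := by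
  induction l using Fin.induction with
  | zero =>
    intro i
    simp only [partialProduct, Fin.induction_zero, rowPoly, genPoly, Matrix.one_apply]
    rw [Finset.sum_eq_single i] <;> simp +contextual [eq_comm]
  | succ l ih =>
    intro i
    have hstep : A.partialProduct θ l.succ = A.layer θ l * A.partialProduct θ l.castSucc := by
      simp [partialProduct]
    have hc := A.compatible l
    rw [hs l, one_mul] at hc
    have hrow := rowPoly_convMatrix (θ l) hc i
    rw [hstep, rowPoly_mul]
    simp only [ih, ← mul_assoc]
    rw [← Finset.sum_mul]
    have hrow' : ∑ b, C (A.layer θ l i b) * X ^ (b : ℕ) = X ^ (i : ℕ) * genPoly (θ l) := by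
      rw [← hrow, layer, hs l]; rfl
    have hset : Finset.univ.filter (fun j : Fin L => j.castSucc < l.succ) =
        insert l (Finset.univ.filter (fun j : Fin L => j.castSucc < l.castSucc)) := by
      ext j
      simp only [Finset.mem_filter, Finset.mem_univ, true_and, Finset.mem_insert, Fin.lt_def,
        Fin.ext_iff, Fin.val_castSucc, Fin.val_succ]
      omega
    rw [hrow', hset, Finset.prod_insert (by simp), mul_assoc]

theorem rowPoly_mu (hs : ∀ l, A.s l = 1) (θ : A.Params) (i : Fin (A.d (Fin.last L))) :
    rowPoly (A.mu θ) i = X ^ (i : ℕ) * A.endPoly θ := by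
  rw [mu, rowPoly_partialProduct A hs, endPoly]
  congr 2
  ext j
  simp [Fin.lt_def]

theorem endPoly_ne_zero (hs : ∀ l, A.s l = 1) (θ : A.Params) (h : A.mu θ ≠ 0) :
    A.endPoly θ ≠ 0 := by
  intro h0
  apply h
  ext i c
  have := A.rowPoly_mu hs θ i
  rw [h0, mul_zero] at this
  rw [← genPoly_coeff (A.mu θ i) c, ← rowPoly, this]
  simp

/-- Telescoping sum over the layers. It gives `K ≤ d 0`, since the output dimension is positive. -/
theorem d_zero_eq (hs : ∀ l, A.s l = 1) :
    A.d 0 + 1 = A.d (Fin.last L) + (1 + ∑ l, (A.k l - 1)) := by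
  have h1 := Fin.sum_univ_castSucc A.d
  rw [Fin.sum_univ_succ] at h1
  have h2 : ∑ l : Fin L, A.d l.castSucc = ∑ l : Fin L, A.d l.succ + ∑ l, (A.k l - 1) := by
    rw [← Finset.sum_add_distrib]
    refine Finset.sum_congr rfl fun l _ => ?_
    have := A.compatible l
    rw [hs l] at this
    have h3 := A.d_pos l.succ
    have h4 := A.k_pos l
    omega
  omega

end Architecture

/-! ### The differential of the loss as a linear form on polynomials. -/

/-- The pairing of a polynomial with the data: the entry `(i, n)` of the product of the
convolutional matrix given by `f` with the data matrix `M`. -/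
def pairing {R : Type*} [CommRing R] {d N : ℕ} (M : Fin d → Fin N → R) (i : ℕ) (n : Fin N) :
    R[X] →ₗ[R] R where
  toFun f := ∑ c : Fin d, (X ^ i * f).coeff c * M c n
  map_add' f g := by simp [mul_add, add_mul, Finset.sum_add_distrib]
  map_smul' t f := by simp [Finset.mul_sum, mul_assoc]

theorem pairing_map {R S : Type*} [CommRing R] [CommRing S] (φ : R →+* S) {d N : ℕ}
    (M : Fin d → Fin N → R) (i : ℕ) (n : Fin N) (f : R[X]) :
    pairing (fun c n => φ (M c n)) i n (f.map φ) = φ (pairing M i n f) := by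
  simp only [pairing, LinearMap.coe_mk, AddHom.coe_mk, map_sum, map_mul]
  rw [show X ^ i * f.map φ = (X ^ i * f).map φ by simp]
  simp only [coeff_map]

theorem pairing_X_pow {R : Type*} [CommRing R] {d N : ℕ} (M : Fin d → Fin N → R) (n : Fin N)
    (j : Fin d) : pairing M 0 n (X ^ (j : ℕ)) = M j n := by
  simp only [pairing, LinearMap.coe_mk, AddHom.coe_mk, pow_zero, one_mul, coeff_X_pow]
  rw [Finset.sum_eq_single j] <;> simp +contextual [Fin.ext_iff]

theorem mu_mul_apply {L N : ℕ} (A : Architecture L) (hs : ∀ l, A.s l = 1) (θ : A.Params)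
    (X : Matrix (Fin (A.d 0)) (Fin N) ℝ) (i : Fin (A.d (Fin.last L))) (n : Fin N) :
    (A.mu θ * X) i n = pairing X i n (A.endPoly θ) := by
  simp only [pairing, LinearMap.coe_mk, AddHom.coe_mk, Matrix.mul_apply]
  refine Finset.sum_congr rfl fun c _ => ?_
  rw [← A.rowPoly_mu hs θ i, rowPoly, genPoly_coeff]

/-- The differential of the square loss at the end-to-end polynomial `P`, as a linear form on
polynomials (up to a factor of two). -/
def residualForm {R : Type*} [CommRing R] {d m N : ℕ} (M : Fin d → Fin N → R)
    (Y : Fin m → Fin N → R) (P : R[X]) : R[X] →ₗ[R] R :=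
  ∑ i : Fin m, ∑ n : Fin N, (pairing M i n P - Y i n) • pairing M i n

theorem residualForm_apply {R : Type*} [CommRing R] {d m N : ℕ} (M : Fin d → Fin N → R)
    (Y : Fin m → Fin N → R) (P f : R[X]) : residualForm M Y P f =
      ∑ i : Fin m, ∑ n : Fin N, (pairing M i n P - Y i n) * pairing M i n f := by
  simp [residualForm, LinearMap.sum_apply]

theorem residualForm_map {R S : Type*} [CommRing R] [CommRing S] (φ : R →+* S) {d m N : ℕ}
    (M : Fin d → Fin N → R) (Y : Fin m → Fin N → R) (P f : R[X]) :
    residualForm (fun c n => φ (M c n)) (fun c n => φ (Y c n)) (P.map φ) (f.map φ) =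
      φ (residualForm M Y P f) := by
  simp [residualForm_apply, pairing_map]

theorem hasDerivAt_sum_sq {ι κ : Type*} [Fintype ι] [Fintype κ] (a b : ι → κ → ℝ) :
    HasDerivAt (fun t : ℝ => ∑ i, ∑ j, (a i j + t * b i j) ^ 2)
      (2 * ∑ i, ∑ j, a i j * b i j) 0 := by
  have : ∀ i ∈ Finset.univ, HasDerivAt (fun t : ℝ => ∑ j, (a i j + t * b i j) ^ 2)
      (∑ j, 2 * (a i j * b i j)) 0 := by
    intro i _
    refine HasDerivAt.fun_sum fun j _ => ?_
    have h := (((hasDerivAt_id (0 : ℝ)).mul_const (b i j)).const_add (a i j)).pow 2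
    refine h.congr_deriv ?_
    simp; ring
  refine (HasDerivAt.fun_sum this).congr_deriv ?_
  simp only [Finset.mul_sum]

/-- The chain rule along the line that moves only the filter of layer `l`, in direction `v`. -/
theorem residualForm_eq_zero_of_isCritical {L N : ℕ} (A : Architecture L) (hs : ∀ l, A.s l = 1)
    (X : Matrix (Fin (A.d 0)) (Fin N) ℝ) (Y : Matrix (Fin (A.d (Fin.last L))) (Fin N) ℝ)
    (θ : A.Params) (h : IsCritical A (fun θ' => squareLoss X Y (A.mu θ')) θ) (l : Fin L)
    (v : Fin (A.k l) → ℝ) :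
    residualForm X Y (A.endPoly θ)
      (genPoly v * ∏ j ∈ Finset.univ.erase l, genPoly (θ j)) = 0 := by
  let dir : A.Params := Pi.single l v
  have hsame : dir l = v := Pi.single_eq_same (M := fun l => Fin (A.k l) → ℝ) l v
  have hne : ∀ j, j ≠ l → dir j = 0 := fun j hj =>
    Pi.single_eq_of_ne (M := fun l => Fin (A.k l) → ℝ) hj v
  set R := ∏ j ∈ Finset.univ.erase l, genPoly (θ j) with hR
  -- The end-to-end polynomial is multilinear in the filters, hence affine along this line, and the
  -- loss is a quadratic function of `t`.
  have hend : ∀ t : ℝ, A.endPoly (θ + t • dir) =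
      A.endPoly θ + t • (genPoly v * R) := by
    intro t
    have hother : ∏ j ∈ Finset.univ.erase l, genPoly ((θ + t • dir : A.Params) j) = R :=
      Finset.prod_congr rfl fun j hj => by
        rw [Pi.add_apply, Pi.smul_apply, hne j (Finset.ne_of_mem_erase hj), smul_zero,
          add_zero]
    rw [Architecture.endPoly, Architecture.endPoly,
      ← Finset.mul_prod_erase _ _ (Finset.mem_univ l), hother,
      ← Finset.mul_prod_erase _ (fun j => genPoly (θ j)) (Finset.mem_univ l), ← hR, Pi.add_apply,
      Pi.smul_apply, hsame, genPoly_add, genPoly_smul, smul_eq_C_mul]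
    ring
  have hline : HasDerivAt (fun t : ℝ => θ + t • dir)
      dir 0 := by
    simpa using ((hasDerivAt_id (0 : ℝ)).smul_const dir).const_add θ
  have hcrit : HasFDerivAt (fun θ' => squareLoss X Y (A.mu θ')) (0 : A.Params →L[ℝ] ℝ)
      (θ + (0 : ℝ) • dir) := by
    rw [zero_smul, add_zero]; exact h
  have h1 := hcrit.comp_hasDerivAt (0 : ℝ) hline
  have h2 := hasDerivAt_sum_sq
    (fun (i : Fin (A.d (Fin.last L))) (n : Fin N) => pairing X i n (A.endPoly θ) - Y i n)
    (fun i n => pairing X i n (genPoly v * R))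
  have heq : (fun θ' => squareLoss X Y (A.mu θ')) ∘ (fun t : ℝ => θ + t • dir) =
      fun t : ℝ => ∑ i : Fin (A.d (Fin.last L)), ∑ n, ((pairing X i n (A.endPoly θ) - Y i n) +
        t * pairing X i n (genPoly v * R)) ^ 2 := by
    funext t
    simp only [Function.comp, squareLoss, Matrix.sub_apply, mu_mul_apply A hs, hend, map_add,
      map_smul, smul_eq_mul]
    refine Finset.sum_congr rfl fun i _ => Finset.sum_congr rfl fun n _ => ?_
    ring
  rw [heq] at h1
  have hzero : 2 * _ = (0 : ℝ) := (h1.unique h2).symm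
  exact (residualForm_apply _ _ _ _).trans ((mul_eq_zero.1 hzero).resolve_left two_ne_zero)

/-! ### One annihilating polynomial from the equations of all layers. -/

/-- If a linear form vanishes on all products `f * ∏ j ≠ l, p j` with `f` of degree at most `e l`,
then it vanishes on the multiples of `h` of bounded degree, where `h` is obtained from `∏ l, p l`
by removing at each of the points `x i` its multiplicity `μ i` as a root of a single factor. -/
theorem map_mul_eq_zero_of_layers {F ι ρ : Type*} [Field F] [Fintype ι] [DecidableEq ι] [Fintype ρ]
    [DecidableEq ρ]
    (G : F[X] →ₗ[F] F) (p : ι → F[X]) (e : ι → ℕ) (hp : ∀ l, p l ≠ 0)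
    (hdeg : ∀ l, (p l).natDegree ≤ e l)
    (hG : ∀ l f, f.natDegree ≤ e l → G (f * ∏ j ∈ Finset.univ.erase l, p j) = 0)
    (x : ρ → F) (hx : Function.Injective x) (μ : ρ → ℕ) (lay : ρ → ι)
    (hμ : ∀ i, (X - C (x i)) ^ μ i ∣ p (lay i)) (top : ι) (c : F) (h : F[X])
    (hP : ∏ l, p l = C c * (h * ∏ i, (X - C (x i)) ^ μ i)) (f : F[X])
    (hf : f.natDegree ≤ ∑ i, μ i + (e top - (p top).natDegree)) : G (f * h) = 0 := by
  have hP0 : ∏ l, p l ≠ 0 := Finset.prod_ne_zero_iff.2 fun l _ => hp l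
  have hc : c ≠ 0 := by
    rintro rfl
    exact hP0 (by rw [hP]; simp)
  have hsplit : ∀ l, p l * ∏ j ∈ Finset.univ.erase l, p j = ∏ l, p l := fun l =>
    Finset.mul_prod_erase _ _ (Finset.mem_univ l)
  have hmonic : ∀ i ∈ Finset.univ, ((X - C (x i)) ^ μ i).Monic := fun i _ =>
    (monic_X_sub_C _).pow _
  set Q := ∏ i, (X - C (x i)) ^ μ i with hQ
  have hQm : Q.Monic := monic_prod_of_monic _ _ hmonic
  have hQdeg : Q.natDegree = ∑ i, μ i := by
    rw [hQ, natDegree_prod_of_monic _ _ hmonic]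
    simp
  have key : ∀ l g q, g * C c * h = q * ∏ j ∈ Finset.univ.erase l, p j → q.natDegree ≤ e l →
      G (g * h) = 0 := by
    intro l g q hgq hq
    have h1 := hG l q hq
    rw [← hgq, show g * C c * h = c • (g * h) by rw [smul_eq_C_mul]; ring, map_smul,
      smul_eq_mul] at h1
    exact (mul_eq_zero.1 h1).resolve_left hc
  -- Partial fractions of `f / Q`: each remainder `r i` has degree below `μ i`. The remainder at `x
  -- i` is handled by the equations of layer `lay i`, the quotient by those of `top`.
  obtain ⟨q, r, hr, hqr⟩ := eq_quo_mul_prod_add_sum_rem_mul_prod (s := Finset.univ) f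
    hmonic (fun i _ j _ hij => (isCoprime_X_sub_C_of_isUnit_sub
      (sub_ne_zero.2 (hx.ne hij)).isUnit).pow)
  rw [← hQ] at hqr
  -- Dividing `p (lay i)` by its factor `(X - C (x i)) ^ μ i` makes room for `r i` within the degree
  -- bound of that layer.
  have hrem : ∀ i, G ((r i * ∏ k ∈ Finset.univ.erase i, (X - C (x k)) ^ μ k) * h) = 0 := by
    intro i
    obtain ⟨p', hp'⟩ := hμ i
    refine key (lay i) _ (r i * p') ?_ ?_
    · apply mul_left_cancel₀ (hmonic i (Finset.mem_univ i)).ne_zero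
      have h2 := Finset.mul_prod_erase Finset.univ (fun k => (X - C (x k)) ^ μ k)
        (Finset.mem_univ i)
      have h3 := hsplit (lay i)
      rw [hP, hQ, ← h2] at h3
      set E := ∏ j ∈ Finset.univ.erase (lay i), p j
      rw [hp'] at h3
      linear_combination (- r i) * h3
    · have h4 := hdeg (lay i)
      by_cases hri : r i = 0
      · simp [hri]
      have hp'0 : p' ≠ 0 := by
        rintro rfl
        exact hp (lay i) (by rw [hp', mul_zero])
      rw [hp', natDegree_mul (hmonic i (Finset.mem_univ i)).ne_zero hp'0] at h4
      have h5 := natDegree_lt_natDegree hri (hr i (Finset.mem_univ i))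
      refine natDegree_mul_le.trans ?_
      omega
  have hquo : G (q * Q * h) = 0 := by
    refine key top _ (q * p top) ?_ ?_
    · linear_combination (-q) * hsplit top - q * hP
    · by_cases hq : q = 0
      · simp [hq]
      -- The fractional part has degree below that of `Q`, so it cannot cancel the leading term of
      -- `q * Q`; this bounds the degree of `q` by that of `f` minus `∑ i, μ i`.
      have hsum : ∑ i, r i * ∏ k ∈ Finset.univ.erase i, (X - C (x k)) ^ μ k ∈
          degreeLT F Q.natDegree := by
        refine Submodule.sum_mem _ fun i hi => ?_
        rw [mem_degreeLT, ← degree_eq_natDegree hQm.ne_zero, hQ,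
          ← Finset.mul_prod_erase _ _ (Finset.mem_univ i), degree_mul, degree_mul]
        refine WithBot.add_lt_add_right ?_ (hr i hi)
        exact degree_ne_bot.2 (monic_prod_of_monic _ _
          fun k _ => hmonic k (Finset.mem_univ k)).ne_zero
      rw [mem_degreeLT, ← degree_eq_natDegree hQm.ne_zero] at hsum
      have hqQ : (q * Q).natDegree = q.natDegree + Q.natDegree := natDegree_mul hq hQm.ne_zero
      have hle : Q.degree ≤ (q * Q).degree := by
        rw [degree_mul, add_comm]
        exact le_add_of_nonneg_right (zero_le_degree_iff.2 hq)
      have hfdeg : f.natDegree = (q * Q).natDegree := by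
        rw [hqr]
        exact natDegree_add_eq_left_of_degree_lt (hsum.trans_le hle)
      have := hdeg top
      refine natDegree_mul_le.trans ?_
      omega
  rw [hqr, add_mul, map_add, hquo, zero_add, Finset.sum_mul, map_sum,
    Finset.sum_eq_zero fun i _ => hrem i]

/-- A linear form vanishing on multiples of the monic polynomial `h` takes on powers of the variable
the values of the linear recurrence sequence with characteristic polynomial `h`. -/
theorem map_X_pow_eq_sum_modByMonic {F : Type*} [Field F] (G : F[X] →ₗ[F] F) {h : F[X]}
    (hm : h.Monic) (D : ℕ) (hG : ∀ f, f.natDegree + h.natDegree ≤ D → G (f * h) = 0) {j : ℕ}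
    (hj : j ≤ D) (hD : h.natDegree ≤ D) :
    G (X ^ j) = ∑ i ∈ Finset.range h.natDegree, G (X ^ i) * (X ^ j %ₘ h).coeff i := by
  have h1 : (X ^ j : F[X]) = X ^ j /ₘ h * h + X ^ j %ₘ h := by
    rw [mul_comm, add_comm]; exact (modByMonic_add_div _ h).symm
  have h2 : G (X ^ j /ₘ h * h) = 0 := by
    apply hG
    rw [natDegree_divByMonic _ hm, natDegree_X_pow]
    omega
  conv_lhs => rw [h1, map_add, h2, zero_add]
  by_cases h0 : h.natDegree = 0
  · rw [hm.natDegree_eq_zero.1 h0]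
    simp
  · rw [as_sum_range' (X ^ j %ₘ h) h.natDegree
      (natDegree_modByMonic_lt _ hm fun h1 => h0 (by simp [h1])), map_sum]
    refine Finset.sum_congr rfl fun i _ => ?_
    rw [← as_sum_range' (X ^ j %ₘ h) h.natDegree
      (natDegree_modByMonic_lt _ hm fun h1 => h0 (by simp [h1])), ← smul_X_eq_monomial, map_smul,
      smul_eq_mul, mul_comm]

/-! ### The normal equations and the parameterization of a stratum of critical points. -/

section Vectors

variable {R S : Type*} [CommRing R] [CommRing S] {d m N : ℕ}

/-- The data side of the normal equations. -/
def dataVec (M : Fin d → Fin N → R) (Y : Fin m → Fin N → R) (j : ℕ) : R :=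
  ∑ i : Fin m, ∑ n : Fin N, Y i n * pairing M i n (X ^ j)

/-- The model side of the normal equations, at the end-to-end polynomial `P`. -/
def modelVec (m : ℕ) (M : Fin d → Fin N → R) (P : R[X]) (j : ℕ) : R :=
  ∑ i : Fin m, ∑ n : Fin N, pairing M i n P * pairing M i n (X ^ j)

/-- The entries of the data vector for which a polynomial with roots `x i` of multiplicities `a i`
can be critical: `s` and `z` are the free values of the differential of the loss, of which those
in degrees at most `D` satisfy a linear recurrence with roots `x i` of multiplicities `b i`. -/
def criticalVec (m : ℕ) {r : ℕ} (a b : Fin r → ℕ) (D : ℕ) (M : Fin d → Fin N → R) (c : R)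
    (x : Fin r → R) (s z : ℕ → R) (j : ℕ) : R :=
  modelVec m M (C c * ∏ i, (X - C (x i)) ^ a i) j -
    if j ≤ D then ∑ i ∈ Finset.range (∑ i, b i),
      s i * (X ^ j %ₘ ∏ i, (X - C (x i)) ^ b i).coeff i
    else z (j - D - 1)

theorem residualForm_X_pow (M : Fin d → Fin N → R) (Y : Fin m → Fin N → R) (P : R[X]) (j : ℕ) :
    residualForm M Y P (X ^ j) = modelVec m M P j - dataVec M Y j := by
  simp [residualForm_apply, modelVec, dataVec, sub_mul, Finset.sum_sub_distrib]

theorem dataVec_map (φ : R →+* S) (M : Fin d → Fin N → R) (Y : Fin m → Fin N → R) (j : ℕ) :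
    φ (dataVec M Y j) = dataVec (fun c n => φ (M c n)) (fun i n => φ (Y i n)) j := by
  have h : (X ^ j : S[X]) = (X ^ j : R[X]).map φ := by simp
  simp only [dataVec, h, pairing_map, map_sum, map_mul]

theorem modelVec_map (φ : R →+* S) (M : Fin d → Fin N → R) (P : R[X]) (j : ℕ) :
    φ (modelVec m M P j) = modelVec m (fun c n => φ (M c n)) (P.map φ) j := by
  have h : (X ^ j : S[X]) = (X ^ j : R[X]).map φ := by simp
  simp only [modelVec, h, pairing_map, map_sum, map_mul]

theorem monic_prod_X_sub_C_pow {r : ℕ} (x : Fin r → R) (b : Fin r → ℕ) :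
    (∏ i, (X - C (x i)) ^ b i).Monic :=
  monic_prod_of_monic _ _ fun _ _ => (monic_X_sub_C _).pow _

/-- Division with remainder by a monic polynomial commutes with ring homomorphisms. So the entries
are universal polynomials in the parameters and specialize from indeterminates to complex values. -/
theorem criticalVec_map (φ : R →+* S) {r : ℕ} (a b : Fin r → ℕ) (D : ℕ)
    (M : Fin d → Fin N → R) (c : R) (x : Fin r → R) (s z : ℕ → R) (j : ℕ) :
    φ (criticalVec m a b D M c x s z j) =
      criticalVec m a b D (fun c n => φ (M c n)) (φ c) (fun i => φ (x i)) (fun i => φ (s i))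
        (fun i => φ (z i)) j := by
  have h : ∀ b : Fin r → ℕ, ∏ i, (X - C (φ (x i))) ^ b i = (∏ i, (X - C (x i)) ^ b i).map φ :=
    fun b => by simp [Polynomial.map_prod]
  have h' : ∀ i, (X ^ j %ₘ ∏ i, (X - C (φ (x i))) ^ b i).coeff i =
      φ ((X ^ j %ₘ ∏ i, (X - C (x i)) ^ b i).coeff i) := fun i => by
    rw [← coeff_map, map_modByMonic _ (monic_prod_X_sub_C_pow x b), h]
    simp
  simp only [criticalVec, map_sub, modelVec_map, h', h a, Polynomial.map_mul, Polynomial.map_C]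
  congr 1
  split_ifs
  · simp
  · rfl

theorem criticalVec_congr {r : ℕ} (a b : Fin r → ℕ) (D : ℕ) {M M' : Fin d → Fin N → R} {c c' : R}
    {x x' : Fin r → R} {s s' z z' : ℕ → R} {j : ℕ} (hM : ∀ c n, M c n = M' c n) (hc : c = c')
    (hx : ∀ i, x i = x' i) (hs : ∀ i < ∑ i, b i, s i = s' i)
    (hz : D < j → z (j - D - 1) = z' (j - D - 1)) :
    criticalVec m a b D M c x s z j = criticalVec m a b D M' c' x' s' z' j := by
  obtain rfl : M = M' := funext fun c => funext fun n => hM c n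
  obtain rfl : x = x' := funext hx
  subst hc
  simp only [criticalVec]
  congr 1
  split_ifs with hj
  · exact Finset.sum_congr rfl fun i hi => by rw [hs i (Finset.mem_range.1 hi)]
  · exact hz (not_le.1 hj)

end Vectors

/-! ### Elimination of the parameters and genericity of the data vector. -/

/-- A polynomial map from a space of smaller dimension satisfies a polynomial relation. -/
theorem exists_relation {κ τ : Type} [Fintype κ] [Fintype τ] {K : ℕ} (hK : Fintype.card τ < K)
    (b : Fin K → MvPolynomial (κ ⊕ τ) ℝ) :
    ∃ F : MvPolynomial (κ ⊕ Fin K) ℝ, F ≠ 0 ∧ ∀ (M : κ → ℝ) (t : τ → ℂ) (c : Fin K → ℝ),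
      (∀ j, (c j : ℂ) = MvPolynomial.aeval (Sum.elim (fun a => (M a : ℂ)) t) (b j)) →
        MvPolynomial.eval (Sum.elim M c) F = 0 := by
  let φ : MvPolynomial (κ ⊕ Fin K) ℝ →ₐ[ℝ] MvPolynomial (κ ⊕ τ) ℝ :=
    MvPolynomial.aeval (Sum.elim (fun a => MvPolynomial.X (Sum.inl a)) b)
  -- An injection would bound the transcendence degree `card κ + K` by `card κ + card τ`. The
  -- coordinates in `κ`, which hold the data matrix, are kept fixed by `φ`.
  have hinj : ¬ Function.Injective φ := by
    intro hinj
    have := trdeg_le_of_injective φ hinj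
    rw [MvPolynomial.trdeg_of_isDomain, MvPolynomial.trdeg_of_isDomain] at this
    simp only [Cardinal.lift_id, Cardinal.mk_fintype, Fintype.card_sum, Fintype.card_fin,
      Nat.cast_le] at this
    omega
  rw [injective_iff_map_eq_zero] at hinj
  push Not at hinj
  obtain ⟨F, hF, hF0⟩ := hinj
  refine ⟨F, hF0, fun M t c hc => ?_⟩
  have hcomp : ((MvPolynomial.aeval (Sum.elim (fun a => (M a : ℂ)) t)).comp φ :
      MvPolynomial (κ ⊕ Fin K) ℝ →ₐ[ℝ] ℂ) =
      MvPolynomial.aeval (algebraMap ℝ ℂ ∘ Sum.elim M c) := by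
    refine MvPolynomial.algHom_ext fun i => ?_
    rcases i with i | i
    · simp [φ]
    · simp [φ, hc]
  have h := DFunLike.congr_fun hcomp F
  rw [AlgHom.comp_apply, hF, map_zero, MvPolynomial.aeval_algebraMap_apply] at h
  simpa [MvPolynomial.coe_aeval_eq_eval] using h.symm

/-- The data vector is generic for generic data. -/
theorem exists_dataVec_pullback {d m N K : ℕ} (hm : 0 < m) (hKd : K ≤ d) (hKN : K ≤ N)
    (F : MvPolynomial ((Fin d × Fin N) ⊕ Fin K) ℝ) (hF : F ≠ 0) :
    ∃ P : MvPolynomial ((Fin d × Fin N) ⊕ (Fin m × Fin N)) ℝ, P ≠ 0 ∧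
      ∀ (M : Fin d → Fin N → ℝ) (Y : Fin m → Fin N → ℝ),
        MvPolynomial.eval (Sum.elim (fun a : Fin d × Fin N => M a.1 a.2) (fun b => Y b.1 b.2)) P =
          MvPolynomial.eval (Sum.elim (fun a : Fin d × Fin N => M a.1 a.2)
            (fun j : Fin K => dataVec M Y j)) F := by
  let P : MvPolynomial ((Fin d × Fin N) ⊕ (Fin m × Fin N)) ℝ :=
    MvPolynomial.aeval (Sum.elim (fun a => MvPolynomial.X (Sum.inl a)) fun j : Fin K =>
      dataVec (fun c n => MvPolynomial.X (Sum.inl (c, n)))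
        (fun i n => MvPolynomial.X (Sum.inr (i, n))) j) F
  have hP : ∀ (M : Fin d → Fin N → ℝ) (Y : Fin m → Fin N → ℝ),
      MvPolynomial.eval (Sum.elim (fun a : Fin d × Fin N => M a.1 a.2) (fun b => Y b.1 b.2)) P =
        MvPolynomial.eval (Sum.elim (fun a : Fin d × Fin N => M a.1 a.2)
            (fun j : Fin K => dataVec M Y j)) F := by
    intro M Y
    have hcomp : (MvPolynomial.aeval (R := ℝ)
          (Sum.elim (fun a : Fin d × Fin N => M a.1 a.2) (fun b => Y b.1 b.2))).comp
        (MvPolynomial.aeval (Sum.elim (fun a => MvPolynomial.X (Sum.inl a)) fun j : Fin K =>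
          dataVec (fun c n => MvPolynomial.X (Sum.inl (c, n)))
            (fun i n => MvPolynomial.X (Sum.inr (i, n))) j)) =
        MvPolynomial.aeval (R := ℝ)
          (Sum.elim (fun a : Fin d × Fin N => M a.1 a.2) (fun j : Fin K => dataVec M Y j)) := by
      refine MvPolynomial.algHom_ext fun i => ?_
      rcases i with i | i
      · simp
      · rw [AlgHom.comp_apply, MvPolynomial.aeval_X, MvPolynomial.aeval_X, Sum.elim_inr,
          Sum.elim_inr, ← AlgHom.coe_toRingHom, dataVec_map]
        simp
    exact DFunLike.congr_fun hcomp F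
  refine ⟨P, fun h0 => ?_, hP⟩
  -- The upper left `K × K` minor of the data matrix.
  let g : MvPolynomial ((Fin d × Fin N) ⊕ Fin K) ℝ :=
    MvPolynomial.rename (fun a : Fin K × Fin K =>
      Sum.inl (Fin.castLE hKd a.1, Fin.castLE hKN a.2)) (Matrix.mvPolynomialX _ _ ℝ).det
  have hg : g ≠ 0 := by
    rw [Ne, MvPolynomial.rename_eq_zero_iff_of_injective]
    · exact Matrix.det_mvPolynomialX_ne_zero _ _
    · intro a b hab
      simpa [Prod.ext_iff] using hab
  obtain ⟨y, hy⟩ : ∃ y, MvPolynomial.eval y (F * g) ≠ 0 := by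
    by_contra! hall
    exact mul_ne_zero hF hg (MvPolynomial.funext fun y => by rw [hall y, map_zero])
  rw [map_mul] at hy
  let M : Fin d → Fin N → ℝ := fun a b => y (Sum.inl (a, b))
  let B : Matrix (Fin K) (Fin K) ℝ := fun a b => M (Fin.castLE hKd a) (Fin.castLE hKN b)
  have hB : IsUnit B.det := by
    have h1 := right_ne_zero_of_mul hy
    rw [MvPolynomial.eval_rename, ← RingHom.coe_coe, RingHom.map_det] at h1
    rw [isUnit_iff_ne_zero]
    convert h1 using 2
    ext a b
    simp [B, M, Matrix.mvPolynomialX]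
  let v : Fin K → ℝ := B⁻¹.mulVec fun j => y (Sum.inr j)
  -- With `Y` supported in its first row and first `K` columns, the data vector is `B` times the
  -- vector `v`, so inverting `B` yields the prescribed value.
  let Y : Fin m → Fin N → ℝ := fun i n =>
    if h : (n : ℕ) < K then if (i : ℕ) = 0 then v ⟨n, h⟩ else 0 else 0
  have hY : ∀ j : Fin K, dataVec M Y j = y (Sum.inr j) := by
    intro j
    have h1 : B.mulVec v = fun j => y (Sum.inr j) := by
      rw [Matrix.mulVec_mulVec, Matrix.mul_nonsing_inv _ hB, Matrix.one_mulVec]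
    rw [← congrFun h1 j, dataVec, Finset.sum_eq_single (⟨0, hm⟩ : Fin m)]
    · have hX : ∀ n, pairing M (⟨0, hm⟩ : Fin m) n (X ^ (j : ℕ)) = M (Fin.castLE hKd j) n :=
        fun n => pairing_X_pow M n (Fin.castLE hKd j)
      simp only [hX, Matrix.mulVec, dotProduct, Y, if_true]
      symm
      refine Finset.sum_of_injOn (Fin.castLE hKN) (Fin.castLE_injective hKN).injOn (by simp)
        ?_ ?_
      · intro n _ hn
        rw [dif_neg, zero_mul]
        intro hnK
        exact hn ⟨⟨n, hnK⟩, by simp, rfl⟩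
      · intro n _
        simp [B, mul_comm]
    · intro i _ hi
      have : (i : ℕ) ≠ 0 := fun h => hi (Fin.ext h)
      simp [Y, this]
    · simp
  apply left_ne_zero_of_mul hy
  have h2 := hP M Y
  rw [h0, map_zero] at h2
  rw [h2]
  congr 2
  funext i
  rcases i with i | i
  · simp [M]
  · simp [hY]

/-- The index set of the free parameters of a stratum. -/
abbrev StratumVar (r H I : ℕ) : Type := Unit ⊕ Fin r ⊕ Fin H ⊕ Fin I

/-- A point with the coordinates of a stratum. -/
def stratumPoint {R : Type*} {r : ℕ} (H I : ℕ) (c : R) (x : Fin r → R) (s z : ℕ → R) :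
    StratumVar r H I → R :=
  Sum.elim (fun _ => c) (Sum.elim x (Sum.elim (fun i => s i) (fun i => z i)))

/-- The polynomials that parameterize the data vectors of a stratum. -/
def criticalPoly {d N : ℕ} (m : ℕ) {r : ℕ} (a b : Fin r → ℕ) (D H I : ℕ) (j : ℕ) :
    MvPolynomial ((Fin d × Fin N) ⊕ StratumVar r H I) ℝ :=
  criticalVec m a b D (fun c n => MvPolynomial.X (Sum.inl (c, n)))
    (MvPolynomial.X (Sum.inr (Sum.inl ())))
    (fun i => MvPolynomial.X (Sum.inr (Sum.inr (Sum.inl i))))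
    (fun i => if h : i < H then
      MvPolynomial.X (Sum.inr (Sum.inr (Sum.inr (Sum.inl ⟨i, h⟩)))) else 0)
    (fun i => if h : i < I then
      MvPolynomial.X (Sum.inr (Sum.inr (Sum.inr (Sum.inr ⟨i, h⟩)))) else 0) j

/-- Replacing the infinite sequences `s`, `z` by finitely many variables, extended by zero, is
harmless: below `D + 1 + I` only the first `∑ i, b i` and `I` values are read. -/
theorem aeval_criticalPoly {d m N r : ℕ} (a b : Fin r → ℕ) {D H I : ℕ} (hH : ∑ i, b i ≤ H)
    (M : Fin d × Fin N → ℂ) (c : ℂ) (x : Fin r → ℂ) (s z : ℕ → ℂ) {j : ℕ} (hj : j < D + 1 + I) :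
    MvPolynomial.aeval (Sum.elim M (stratumPoint H I c x s z)) (criticalPoly m a b D H I j) =
      criticalVec m a b D (fun c n => M (c, n)) c x s z j := by
  rw [criticalPoly, ← AlgHom.coe_toRingHom, criticalVec_map]
  refine criticalVec_congr a b D (fun c n => ?_) ?_ (fun i => ?_) (fun i hi => ?_) fun hDj => ?_
  · simp
  · simp [stratumPoint]
  · simp [stratumPoint]
  · have hi' : i < H := hi.trans_le hH
    simp [stratumPoint, hi']
  · have : j - D - 1 < I := by omega
    simp [stratumPoint, this]

/-- Generic data do not satisfy the normal equations of a stratum of positive codimension. -/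
theorem forGenericData_ne_criticalVec {d m N K : ℕ} (hm : 0 < m) (hKd : K ≤ d) (hKN : K ≤ N)
    {r : ℕ} (a b : Fin r → ℕ) (D : ℕ) (hdim : 1 + r + ∑ i, b i + (K - 1 - D) < K) :
    ForGenericData (n := d) (m := m) (N := N) fun M Y =>
      ¬ ∃ (c : ℂ) (x : Fin r → ℂ) (s z : ℕ → ℂ), ∀ j < K,
        ((dataVec M Y j : ℝ) : ℂ) = criticalVec m a b D (fun c n => (M c n : ℂ)) c x s z j := by
  obtain ⟨F, hF, hrel⟩ := exists_relation (κ := Fin d × Fin N)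
    (τ := StratumVar r (∑ i, b i) (K - 1 - D)) (K := K)
    (by simp only [Fintype.card_sum, Fintype.card_unit, Fintype.card_fin]; omega)
    (fun j => criticalPoly m a b D _ _ j)
  obtain ⟨P, hP, hPF⟩ := exists_dataVec_pullback hm hKd hKN F hF
  refine ⟨P, hP, fun M Y hMY => ?_⟩
  rintro ⟨c, x, s, z, h⟩
  refine hMY ((hPF M Y).trans (hrel (fun a => M a.1 a.2) (stratumPoint _ _ c x s z) _ fun j => ?_))
  rw [aeval_criticalPoly a b le_rfl _ c x s z (by omega)]
  exact h j j.2

/-! ### Operations on generic properties. -/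

theorem ForGenericData.const_true {n m N : ℕ} :
    ForGenericData (n := n) (m := m) (N := N) fun _ _ => True :=
  ⟨1, one_ne_zero, fun _ _ _ => trivial⟩

theorem ForGenericData.mono {n m N : ℕ}
    {S T : Matrix (Fin n) (Fin N) ℝ → Matrix (Fin m) (Fin N) ℝ → Prop} (h : ForGenericData S)
    (hST : ∀ X Y, S X Y → T X Y) : ForGenericData T := by
  obtain ⟨P, hP, hS⟩ := h
  exact ⟨P, hP, fun X Y hXY => hST X Y (hS X Y hXY)⟩

theorem ForGenericData.forall {n m N : ℕ} {σ : Type*} [Fintype σ]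
    {S : σ → Matrix (Fin n) (Fin N) ℝ → Matrix (Fin m) (Fin N) ℝ → Prop}
    (h : ∀ a, ForGenericData (S a)) : ForGenericData fun X Y => ∀ a, S a X Y := by
  choose P hP hS using h
  refine ⟨∏ a, P a, Finset.prod_ne_zero_iff.2 fun a _ => hP a, fun X Y hXY a => hS a X Y ?_⟩
  rw [map_prod] at hXY
  exact Finset.prod_ne_zero_iff.1 hXY a (Finset.mem_univ a)

/-! ### Repeated roots in the affine chart and at infinity. -/

/-- `genPoly` dehomogenizes `filterPoly` at `x = 1`, so the point with `r 0 = 0` is at infinity and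
a root there lowers the degree. A drop by one suffices: infinity is a fixed point and costs no
parameter in the dimension count. -/
theorem natDegree_lt_or_rootMultiplicity_of_hasRepeatedRoot {k : ℕ} (w : Fin k → ℝ)
    (hw : genPoly w ≠ 0) (h : HasRepeatedRoot (filterPoly w)) :
    (genPoly w).natDegree < k - 1 ∨
      ∃ x : ℂ, 2 ≤ rootMultiplicity x ((genPoly w).map (algebraMap ℝ ℂ)) := by
  have hk : 0 < k := by
    rcases Nat.eq_zero_or_pos k with rfl | hk
    · exact absurd (by simp [genPoly]) hw
    · exact hk
  obtain ⟨r, hr, hdvd⟩ := h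
  by_cases hr0 : r 0 = 0
  · left
    have hr1 : r 1 ≠ 0 := fun hr1 => hr (by ext i; fin_cases i <;> simp [hr0, hr1])
    -- In the chart `y = 1`, evaluation at zero isolates the last entry of the filter, the
    -- coefficient of degree `k - 1` in `genPoly w`.
    have h1 := map_dvd (MvPolynomial.aeval ![(X : ℂ[X]), 1]) hdvd
    obtain ⟨q, hq⟩ := h1
    have h2 := congrArg (eval 0) hq
    simp only [filterPoly, map_sum, map_mul, map_pow, MvPolynomial.map_C, MvPolynomial.map_X,
      hr0] at h2
    simp [eval_finsetSum] at h2
    have hlast : w ⟨k - 1, by omega⟩ = 0 := by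
      rw [Finset.sum_eq_single (⟨k - 1, by omega⟩ : Fin k)] at h2
      · simpa using h2
      · intro j _ hj
        have : k - 1 - (j : ℕ) ≠ 0 := fun h => hj (Fin.ext (by simp; omega))
        simp [this]
      · simp
    have h3 := genPoly_natDegree_lt hk w
    have h4 : (genPoly w).natDegree ≠ k - 1 := by
      intro h5
      apply hw
      rw [← leadingCoeff_eq_zero, leadingCoeff, h5, ← hlast]
      exact genPoly_coeff w ⟨k - 1, by omega⟩
    omega
  · right
    have h1 := map_dvd (MvPolynomial.aeval ![(1 : ℂ[X]), X]) hdvd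
    have h2 : MvPolynomial.aeval ![(1 : ℂ[X]), X]
        (MvPolynomial.map (algebraMap ℝ ℂ) (filterPoly w)) =
          (genPoly w).map (algebraMap ℝ ℂ) := by
      simp [filterPoly, genPoly, Polynomial.map_sum]
    have h3 : MvPolynomial.aeval ![(1 : ℂ[X]), X]
        ((MvPolynomial.C (r 1) * MvPolynomial.X 0 - MvPolynomial.C (r 0) * MvPolynomial.X 1) ^ 2) =
          C (r 0 ^ 2) * (X - C (r 1 / r 0)) ^ 2 := by
      have : (C (r 1) : ℂ[X]) = C (r 0) * C (r 1 / r 0) := by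
        rw [← C_mul, mul_div_cancel₀ _ hr0]
      simp [this]
      ring
    rw [h2, h3] at h1
    refine ⟨r 1 / r 0, ?_⟩
    rw [le_rootMultiplicity_iff
      ((Polynomial.map_ne_zero_iff (algebraMap ℝ ℂ).injective).2 hw)]
    exact (dvd_mul_left _ _).trans h1

theorem eq_C_mul_prod_roots {p : ℂ[X]} :
    p = C p.leadingCoeff * ∏ i : Fin p.roots.toFinset.card,
      (X - C (p.roots.toFinset.equivFin.symm i : ℂ)) ^
        rootMultiplicity (p.roots.toFinset.equivFin.symm i : ℂ) p := by
  conv_lhs => rw [(IsAlgClosed.splits p).eq_prod_roots, Finset.prod_multiset_map_count]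
  congr 1
  rw [← Finset.prod_coe_sort]
  refine (Equiv.prod_comp p.roots.toFinset.equivFin.symm _).symm.trans ?_
  simp only [count_roots]

/-! ### Every critical point with a repeated root lies in a small stratum. -/

/-- Combinatorial types of critical points: the number of roots, their multiplicities in the
end-to-end polynomial and in the annihilator of the differential, and a degree bound. -/
abbrev CriticalType (K : ℕ) : Type :=
  Σ r : Fin K, (Fin r → Fin K) × (Fin r → Fin K) × Fin K

/-- The stratum of a combinatorial type has positive codimension. -/
def CriticalType.IsSmall {K : ℕ} (t : CriticalType K) : Prop :=
  1 + (t.1 : ℕ) + ∑ i, (t.2.2.1 i : ℕ) + (K - 1 - (t.2.2.2 : ℕ)) < K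

/-- The data vector has the form that it takes at a critical point of type `t`. -/
def CriticalType.Realizes {K d m N : ℕ} (t : CriticalType K) (M : Fin d → Fin N → ℝ)
    (Y : Fin m → Fin N → ℝ) : Prop :=
  ∃ (c : ℂ) (x : Fin t.1 → ℂ) (s z : ℕ → ℂ), ∀ j < K,
    ((dataVec M Y j : ℝ) : ℂ) = criticalVec m (fun i => (t.2.1 i : ℕ)) (fun i => (t.2.2.1 i : ℕ))
      t.2.2.2 (fun c n => (M c n : ℂ)) c x s z j

/-- The real critical equations for the monomials extend to complex `f` by linearity. -/
theorem residualForm_layer_eq_zero {L N : ℕ} (A : Architecture L) (hs : ∀ l, A.s l = 1)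
    (X : Matrix (Fin (A.d 0)) (Fin N) ℝ) (Y : Matrix (Fin (A.d (Fin.last L))) (Fin N) ℝ)
    (θ : A.Params) (h : IsCritical A (fun θ' => squareLoss X Y (A.mu θ')) θ) (l : Fin L)
    (f : ℂ[X]) (hf : f.natDegree ≤ A.k l - 1) :
    residualForm (fun c n => (X c n : ℂ)) (fun i n => (Y i n : ℂ))
      ((A.endPoly θ).map (algebraMap ℝ ℂ))
      (f * ∏ j ∈ Finset.univ.erase l, (genPoly (θ j)).map (algebraMap ℝ ℂ)) = 0 := by
  have hk := A.k_pos l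
  rw [as_sum_range' f (A.k l) (by omega), Finset.sum_mul, map_sum]
  refine Finset.sum_eq_zero fun m hm => ?_
  have h1 := residualForm_eq_zero_of_isCritical A hs X Y θ h l
    (Pi.single ⟨m, Finset.mem_range.1 hm⟩ 1)
  rw [genPoly_single] at h1
  have h2 := residualForm_map (algebraMap ℝ ℂ) X Y (A.endPoly θ)
    (Polynomial.X ^ m * ∏ j ∈ Finset.univ.erase l, genPoly (θ j))
  have h3 := h2.trans ((congrArg _ h1).trans (map_zero _))
  rw [Polynomial.map_mul, Polynomial.map_pow, map_X, Polynomial.map_prod] at h3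
  rw [← smul_X_eq_monomial, smul_mul_assoc, map_smul]
  exact (congrArg _ h3).trans (smul_zero _)

theorem exists_criticalType {L N : ℕ} (A : Architecture L) (hs : ∀ l, A.s l = 1)
    (X : Matrix (Fin (A.d 0)) (Fin N) ℝ) (Y : Matrix (Fin (A.d (Fin.last L))) (Fin N) ℝ)
    (θ : A.Params) (hcrit : IsCritical A (fun θ' => squareLoss X Y (A.mu θ')) θ)
    (hne : A.mu θ ≠ 0) (l₀ : Fin L) (hrep : HasRepeatedRoot (filterPoly (θ l₀))) :
    ∃ t : CriticalType (1 + ∑ l, (A.k l - 1)), t.IsSmall ∧ t.Realizes X Y := by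
  set K := 1 + ∑ l, (A.k l - 1) with hK
  have hP0 : A.endPoly θ ≠ 0 := A.endPoly_ne_zero hs θ hne
  have hw0 : ∀ l, genPoly (θ l) ≠ 0 := fun l =>
    Finset.prod_ne_zero_iff.1 hP0 l (Finset.mem_univ l)
  let p : Fin L → ℂ[X] := fun l => (genPoly (θ l)).map (algebraMap ℝ ℂ)
  have hp0 : ∀ l, p l ≠ 0 := fun l =>
    (Polynomial.map_ne_zero_iff (algebraMap ℝ ℂ).injective).2 (hw0 l)
  have hpdeg : ∀ l, (p l).natDegree ≤ A.k l - 1 := fun l => by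
    have := genPoly_natDegree_lt (A.k_pos l) (θ l)
    simp only [p, natDegree_map]
    omega
  have hrep' : (p l₀).natDegree < A.k l₀ - 1 ∨ ∃ y : ℂ, 2 ≤ rootMultiplicity y (p l₀) := by
    simpa [p] using natDegree_lt_or_rootMultiplicity_of_hasRepeatedRoot (θ l₀) (hw0 l₀) hrep
  set P : ℂ[X] := (A.endPoly θ).map (algebraMap ℝ ℂ) with hPdef
  have hPp : P = ∏ l, p l := by
    simp only [hPdef, Architecture.endPoly, Polynomial.map_prod, p]
  have hPne : P ≠ 0 := (Polynomial.map_ne_zero_iff (algebraMap ℝ ℂ).injective).2 hP0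
  have hdvd : ∀ l, p l ∣ P := fun l => hPp ▸ Finset.dvd_prod_of_mem p (Finset.mem_univ l)
  let r := P.roots.toFinset.card
  let x : Fin r → ℂ := fun i => (P.roots.toFinset.equivFin.symm i : ℂ)
  have hx : Function.Injective x :=
    Subtype.val_injective.comp P.roots.toFinset.equivFin.symm.injective
  have hroot : ∀ i, P.IsRoot (x i) := fun i =>
    (mem_roots hPne).1 (Multiset.mem_toFinset.1 (P.roots.toFinset.equivFin.symm i).2)
  have hsurj : ∀ y, P.IsRoot y → ∃ i, x i = y := fun y hy =>
    ⟨P.roots.toFinset.equivFin ⟨y, Multiset.mem_toFinset.2 ((mem_roots hPne).2 hy)⟩, by simp [x]⟩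
  -- A root shared by several layers is assigned to `l₀` whenever possible, so that a multiple root
  -- of `p l₀` gives `μ i ≥ 2`.
  have hlay : ∀ i, ∃ l, 1 ≤ rootMultiplicity (x i) (p l) ∧
      (1 ≤ rootMultiplicity (x i) (p l₀) → l = l₀) := by
    intro i
    by_cases h : 1 ≤ rootMultiplicity (x i) (p l₀)
    · exact ⟨l₀, h, fun _ => rfl⟩
    · have h1 := hroot i
      rw [hPp, IsRoot.def, eval_prod, Finset.prod_eq_zero_iff] at h1
      obtain ⟨l, _, hl⟩ := h1
      exact ⟨l, (rootMultiplicity_pos (hp0 l)).2 hl, fun h' => absurd h' h⟩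
  choose lay hlay1 hlay2 using hlay
  let a : Fin r → ℕ := fun i => rootMultiplicity (x i) P
  let μ : Fin r → ℕ := fun i => rootMultiplicity (x i) (p (lay i))
  have hμa : ∀ i, μ i ≤ a i := fun i => rootMultiplicity_le_rootMultiplicity_of_dvd hPne (hdvd _) _
  let b : Fin r → ℕ := fun i => a i - μ i
  have hba : ∀ i, b i + μ i = a i := fun i => Nat.sub_add_cancel (hμa i)
  have hPfac : P = C P.leadingCoeff * ∏ i, (Polynomial.X - C (x i)) ^ a i := eq_C_mul_prod_roots
  have hlc : P.leadingCoeff ≠ 0 := leadingCoeff_ne_zero.2 hPne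
  have hsumb : ∀ b : Fin r → ℕ, (∏ i, (Polynomial.X - C (x i)) ^ b i).natDegree = ∑ i, b i := by
    intro b
    rw [natDegree_prod_of_monic _ _ fun i _ => (monic_X_sub_C _).pow _]
    simp
  have hsuma : ∑ i, a i = P.natDegree := by
    conv_rhs => rw [hPfac]
    rw [natDegree_C_mul hlc, hsumb]
  have hsumbμ : ∑ i, b i + ∑ i, μ i = P.natDegree := by
    rw [← hsuma, ← Finset.sum_add_distrib]
    exact Finset.sum_congr rfl fun i _ => hba i
  have hPdeg : P.natDegree + ∑ l, (A.k l - 1 - (p l).natDegree) = K - 1 := by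
    rw [hPp, natDegree_prod _ _ fun l _ => hp0 l, ← Finset.sum_add_distrib, hK,
      Nat.add_sub_cancel_left]
    exact Finset.sum_congr rfl fun l _ => Nat.add_sub_cancel' (hpdeg l)
  have htop : A.k l₀ - 1 - (p l₀).natDegree ≤ ∑ l, (A.k l - 1 - (p l).natDegree) :=
    Finset.single_le_sum (f := fun l => A.k l - 1 - (p l).natDegree)
      (fun _ _ => Nat.zero_le _) (Finset.mem_univ l₀)
  have hKpos : 0 < K := by omega
  have hr : r = ∑ _i : Fin r, 1 := by simp
  -- The codimension is positive: every root contributes at least one to `∑ i, μ i`, and the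
  -- repeated root contributes an extra one, either there or in the degree drop.
  have hcodim : r < ∑ i, μ i + (A.k l₀ - 1 - (p l₀).natDegree) := by
    have hle : ∑ _i : Fin r, 1 ≤ ∑ i, μ i := Finset.sum_le_sum fun i _ => hlay1 i
    rcases hrep' with h | ⟨y, hy⟩
    · omega
    · obtain ⟨i, hi⟩ := hsurj y
        (((rootMultiplicity_pos (hp0 l₀)).1 (by omega)).dvd (hdvd l₀))
      have hi2 : 1 < μ i := by
        have h1 := hlay2 i (by rw [hi]; omega)
        simp only [μ, h1, hi]
        omega
      have hlt : ∑ _i : Fin r, 1 < ∑ i, μ i :=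
        Finset.sum_lt_sum (fun i _ => hlay1 i) ⟨i, Finset.mem_univ i, hi2⟩
      omega
  have hrK : r < K := by
    have : ∑ _i : Fin r, 1 ≤ ∑ i, a i :=
      Finset.sum_le_sum fun i _ => (hlay1 i).trans (hμa i)
    omega
  have haK : ∀ i, a i < K := fun i => by
    have := Finset.single_le_sum (f := a) (fun _ _ => Nat.zero_le _) (Finset.mem_univ i)
    omega
  have hbK : ∀ i, b i < K := fun i => by
    have := haK i
    have := hba i
    omega
  -- The largest degree for which the layer equations control `G` on multiples of `h`: the quotient
  -- part may use the unused degree of layer `l₀`.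
  let D := P.natDegree + (A.k l₀ - 1 - (p l₀).natDegree)
  have hDK : D < K := by simp only [D]; omega
  let h := ∏ i, (Polynomial.X - C (x i)) ^ b i
  have hfac : ∏ l, p l =
      C P.leadingCoeff * (h * ∏ i, (Polynomial.X - C (x i)) ^ μ i) := by
    rw [← hPp, ← Finset.prod_mul_distrib]
    simp only [← pow_add, hba]
    exact hPfac
  let G := residualForm (fun c n => (X c n : ℂ)) (fun i n => (Y i n : ℂ)) P
  have hGh : ∀ f, f.natDegree + h.natDegree ≤ D → G (f * h) = 0 := by
    intro f hf
    refine map_mul_eq_zero_of_layers G p (fun l => A.k l - 1) hp0 hpdeg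
      (residualForm_layer_eq_zero A hs X Y θ hcrit) x hx μ lay
      (fun i => pow_rootMultiplicity_dvd _ _) l₀ _ h hfac f ?_
    rw [hsumb] at hf
    simp only [D] at hf
    omega
  -- The free parameters are values of `G` on monomials: the initial ones start the recurrence, and
  -- those from degree `D + 1` on are unconstrained.
  refine ⟨⟨⟨r, hrK⟩, fun i => ⟨a i, haK i⟩, fun i => ⟨b i, hbK i⟩, ⟨D, hDK⟩⟩, ?_,
    P.leadingCoeff, x, fun i => G (Polynomial.X ^ i), fun i => G (Polynomial.X ^ (i + D + 1)),
    fun j hj => ?_⟩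
  · simp only [CriticalType.IsSmall, D]
    omega
  · have h1 : G (Polynomial.X ^ j) = _ :=
      residualForm_X_pow (fun c n => (X c n : ℂ)) (fun i n => (Y i n : ℂ)) P j
    have h2 := dataVec_map (algebraMap ℝ ℂ) X Y j
    have h3 : ((dataVec X Y j : ℝ) : ℂ) =
        modelVec (A.d (Fin.last L)) (fun c n => (X c n : ℂ)) P j - G (Polynomial.X ^ j) := by
      rw [h1, sub_sub_cancel]
      exact h2
    rw [h3]
    simp only [criticalVec]
    rw [← hPfac]
    congr 1
    split_ifs with hjD
    · rw [map_X_pow_eq_sum_modByMonic G (monic_prod_X_sub_C_pow x b) D hGh hjD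
        (by rw [hsumb]; simp only [D]; omega), hsumb]
    · rw [show j - D - 1 + D + 1 = j by omega]

end LCN

end

/-! ### Conclusion: all small strata are avoided at once. -/

theorem mainTheorem4 {L N : ℕ} (A : LCN.Architecture L) (hs : ∀ l, A.s l = 1)
    (hN : A.d 0 ≤ N) :
    LCN.ForGenericData (n := A.d 0) (m := A.d (Fin.last L)) (N := N) (fun X Y =>
      ∀ θ : A.Params,
        LCN.IsCritical A (fun θ' => LCN.squareLoss X Y (A.mu θ')) θ →
        A.mu θ ≠ 0 →
        ∀ l : Fin L, ¬ LCN.HasRepeatedRoot (LCN.filterPoly (θ l))) := by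
  have hd := A.d_zero_eq hs
  have hpos := A.d_pos (Fin.last L)
  have hgen : ∀ t : LCN.CriticalType (1 + ∑ l, (A.k l - 1)),
      LCN.ForGenericData (n := A.d 0) (m := A.d (Fin.last L)) (N := N) fun X Y =>
        t.IsSmall → ¬ t.Realizes X Y := by
    intro t
    by_cases ht : t.IsSmall
    · exact (LCN.forGenericData_ne_criticalVec hpos (by omega) (by omega) _ _ _ ht).mono
        fun X Y h _ => h
    · exact LCN.ForGenericData.const_true.mono fun X Y _ h => absurd h ht
  -- There are finitely many types, so the product of their relations is a single nonzero
  -- polynomial.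
  refine (LCN.ForGenericData.forall hgen).mono fun X Y hXY θ hcrit hne l hrep => ?_
  obtain ⟨t, ht, hreal⟩ := LCN.exists_criticalType A hs X Y θ hcrit hne l hrep
  exact hXY t ht hreal
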